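/- A turnstile stream for an $m\times n$ matrix is a finite sequence of updates $((i,j),c)$ with $(i,j)\in[m]\times[n]$ and $c\in\mathbb Z$; it defines the matrix $\mathbf A$ obtained from $\mathbf 0^{m\times n}$ by adding, for each update in turn, $c$ to the entry $(i,j)$. Words have $\ell$ bits, and the streams considered are those in which all update values, and all entries of the matrix at every moment, fit in a (signed) word, i.e. have absolute value less than $2^{\ell-1}$. A randomized single-pass algorithm using $S$ words keeps a memory of $S$ words of $\ell$ bits; it sets up the memory, replaces its content after each update as a function of the previous content, the update, the time and its random coins (which are not charged to the space), and finally outputs a real $m\times n$ matrix $\mathbf B$ determined by the final content and the coins. It solves $(\alpha,\beta,\gamma,k)$-low-rank approximation if for every such stream, with $\mathbf A$ the matrix defined by the stream, $$\Pr\Big[\operatorname{rank}(\mathbf B)\le k\ \text{ and }\ \|\mathbf A-\mathbf B\|_F\le(1+\alpha)\min_{\operatorname{rank}(\mathbf X)\le k}\|\mathbf A-\mathbf X\|_F+\gamma\Big]\ \ge\ 1-\beta .$$ Theorem. There is an absolute constant $c>0$ such that for every $C>0$ there is a $K>0$ with the following property. Let $m,n,k,\ell\in\mathbb N$, $\alpha>0$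 and $\gamma\le C(m+n)$, let $\frac{k}{20\alpha}\le\frac12\min\{m,n\}$ and $\ell\ge K\log_2(m+n)$. Then every randomized single-pass turnstile algorithm that solves $(\alpha,5/6,\gamma,k)$-low-rank approximation of $m\times n$ matrices (i.e. that succeeds with probability at least $1/6$ on every stream) uses at least $c\,(m+n)k/\alpha$ words of space. -/

import Mathlib

open scoped Matrix.Norms.Frobenius

/-- A turnstile update `((i, j), c)`: the integer `c` is added to the entry `(i, j)`. -/
abbrev TurnstileUpdate (m n : ℕ) : Type := (Fin m × Fin n) × ℤ

/-- The matrix obtained from the zero matrix by applying all the updates of a stream. -/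
def streamMatrix {m n : ℕ} (σ : List (TurnstileUpdate m n)) : Matrix (Fin m) (Fin n) ℤ :=
  (σ.map fun u => Matrix.single u.1.1 u.1.2 u.2).sum

/-- An integer that is representable in one (signed) word of `ℓ` bits: `|x| < 2 ^ (ℓ - 1)`. -/
def FitsWord (ℓ : ℕ) (x : ℤ) : Prop := 2 * |x| < 2 ^ ℓ

/-- A stream over words of `ℓ` bits: every update value, and every entry of the matrix at every
moment of the stream, fits in one word. -/
def IsWordStream {m n : ℕ} (ℓ : ℕ) (σ : List (TurnstileUpdate m n)) : Prop :=
  (∀ u ∈ σ, FitsWord ℓ u.2) ∧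
    ∀ p : List (TurnstileUpdate m n), p <+: σ → ∀ i j, FitsWord ℓ (streamMatrix p i j)

/-- A memory of `S` words of `ℓ` bits each. -/
abbrev Memory (S ℓ : ℕ) : Type := Fin S → Fin ℓ → Bool

/-- A randomized single-pass algorithm on turnstile streams for `m × n` matrices whose data
structure occupies `S` words of `ℓ` bits. The random coins are a point `ω` of the sample space `Ω`;
neither they nor the time `τ` are charged to the space, and having `τ` as an argument of `step`
lets the algorithm use fresh coins in every step. The answer depends only on the final content of
the memory and on the coins. -/
structure TurnstileAlgorithm (m n S ℓ : ℕ) (Ω : Type*) where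
  init : Ω → Memory S ℓ
  step : ℕ → Ω → Memory S ℓ → TurnstileUpdate m n → Memory S ℓ
  output : Ω → Memory S ℓ → Matrix (Fin m) (Fin n) ℝ

namespace TurnstileAlgorithm

variable {m n S ℓ : ℕ} {Ω : Type*}

/-- Content of the memory after processing a stream that starts at time `τ` with content `s`. -/
def runFrom (alg : TurnstileAlgorithm m n S ℓ Ω) (ω : Ω) :
    ℕ → Memory S ℓ → List (TurnstileUpdate m n) → Memory S ℓ
  | _, s, [] => s
  | τ, s, u :: σ => alg.runFrom ω (τ + 1) (alg.step τ ω s u) σ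

/-- The answer of the algorithm after one pass over the stream `σ` with coins `ω`. -/
def answer (alg : TurnstileAlgorithm m n S ℓ Ω) (ω : Ω) (σ : List (TurnstileUpdate m n)) :
    Matrix (Fin m) (Fin n) ℝ :=
  alg.output ω (alg.runFrom ω 0 (alg.init ω) σ)

end TurnstileAlgorithm

/-- The least Frobenius distance from `A` to a matrix of rank at most `k`. -/
noncomputable def lowRankError {m n : ℕ} (k : ℕ) (A : Matrix (Fin m) (Fin n) ℝ) : ℝ :=
  ⨅ X : {X : Matrix (Fin m) (Fin n) ℝ // X.rank ≤ k}, ‖A - X.1‖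

/-- `B` is a matrix of rank at most `k` that approximates `A` within the multiplicative error
`1 + α` and the additive error `γ` in the Frobenius norm. -/
def IsLowRankApprox {m n : ℕ} (α γ : ℝ) (k : ℕ) (A B : Matrix (Fin m) (Fin n) ℝ) : Prop :=
  B.rank ≤ k ∧ ‖A - B‖ ≤ (1 + α) * lowRankError k A + γ

/-- The algorithm solves `(α, β, γ, k)`-low-rank approximation in the turnstile model: on every
stream over words of `ℓ` bits, it succeeds with probability at least `1 - β` over its coins. -/
def SolvesLRA {m n S ℓ : ℕ} {Ω : Type*} [MeasurableSpace Ω] (μ : MeasureTheory.Measure Ω)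
    (alg : TurnstileAlgorithm m n S ℓ Ω) (α β γ : ℝ) (k : ℕ) : Prop :=
  ∀ σ : List (TurnstileUpdate m n), IsWordStream ℓ σ →
    MeasurableSet
        {ω | IsLowRankApprox α γ k ((streamMatrix σ).map (Int.cast : ℤ → ℝ)) (alg.answer ω σ)} ∧
      1 - β ≤ μ.real
        {ω | IsLowRankApprox α γ k ((streamMatrix σ).map (Int.cast : ℤ → ℝ)) (alg.answer ω σ)}

/-! The bound is an augmented-indexing argument. Put a string of q-ary digits, q = 2^20, on J levels
(J proportional to ℓ) at each of N·k'·n' matrix positions, level i having weight D(8q)^i, and let a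
stream write the resulting integers. For a level j and a block b of positions, a continuation that
depends only on the digits above j erases those digits and adds a fixed matrix `G b`. If every
low-rank approximation of the result is accurate on most of block b (`BlockDecodable`), rounding its
entries recovers most digits of level j in that block. Success probability 1/6 and accuracy 9/10
give, for some fixed coins, a predictor working from the memory content that is right on 3/20 of all
digits on average.

For a fixed memory content, predictions from the top level down satisfy ∑ q^(number correct) ≤
(2q)^t over all inputs, with t digits in all (`sum_pow_correct_le`). Summing over contents and using
convexity gives q^(3t/20) ≤ 2^(Sℓ)·2^t (`rpow_le_of_blockDecodable`), hence 2t ≤ Sℓ. Since t is of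
order ℓ·N·k'·n', this gives S of order N·k'·n'.

It remains to find decodable blocks with order (m+n)k/α entries (`hasLargeBlocks`). For small α take
about 1/(2^50 α) blocks of k rows, and let `G b` be a huge multiple P of the identity in the rows of
b and k spare columns. A good rank-k matrix must spend its rank there, so it is nearly zero on the
other blocks (`abs_apply_le_of_rank_le`). It therefore already pays almost the optimal error outside
b, and the slack 1 + α leaves only a small mean square error on b (`blockDecodable_dominant`). For α
bounded below, at most k full rows suffice: the matrix has rank at most k and only the additive
error remains (`blockDecodable_rows`). -/

/-! ### Counting: sequential prediction from a small state -/

section Counting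

variable {E : Type*} [Fintype E] [DecidableEq E]

/-- The sum factors over the entries, and each factor is q + (q - 1): weight q for the guessed
symbol and 1 for every other. -/
lemma sum_pow_card_eq_le (q : ℕ) (g : E → Fin q) :
    ∑ y : E → Fin q, q ^ (Finset.univ.filter fun e => y e = g e).card
      ≤ (2 * q) ^ Fintype.card E := by
  have h1 : ∀ y : E → Fin q, q ^ (Finset.univ.filter fun e => y e = g e).card
      = ∏ e, if y e = g e then q else 1 := by
    intro y
    rw [Finset.prod_ite]
    simp
  simp_rw [h1]
  have h2 := Finset.prod_univ_sum (fun _ : E => (Finset.univ : Finset (Fin q)))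
    (fun e a => if a = g e then q else 1)
  rw [Fintype.piFinset_univ] at h2
  rw [← h2]
  calc _ ≤ ∏ _e : E, 2 * q := by
        apply Finset.prod_le_prod'
        intro e _
        calc ∑ a : Fin q, (if a = g e then q else 1)
            ≤ ∑ a : Fin q, ((if a = g e then q else 0) + 1) := by
              apply Finset.sum_le_sum
              intro a _
              split_ifs <;> omega
          _ = 2 * q := by
              rw [Finset.sum_add_distrib]
              simp
              ring
    _ = _ := by simp

/-- A predictor that guesses the levels from the top down, knowing all levels above the one it
guesses, cannot be right on many entries for many inputs. -/
lemma sum_pow_correct_le (q : ℕ) [NeZero q] (J : ℕ)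
    (g : Fin J → (Fin J → E → Fin q) → E → Fin q)
    (hg : ∀ j x y, (∀ i, j < i → x i = y i) → g j x = g j y) :
    ∑ x : Fin J → E → Fin q, q ^ (∑ j, (Finset.univ.filter fun e => x j e = g j x e).card)
      ≤ (2 * q) ^ (J * Fintype.card E) := by
  induction J with
  | zero => simp
  | succ J ih =>
    rw [← (Fin.consEquiv (fun _ : Fin (J + 1) => E → Fin q)).sum_comp, Fintype.sum_prod_type_right]
    have key : ∀ (x' : Fin J → E → Fin q) (y : E → Fin q),
        q ^ (∑ j, (Finset.univ.filter fun e =>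
          (Fin.consEquiv (fun _ : Fin (J + 1) => E → Fin q)) (y, x') j e
            = g j ((Fin.consEquiv (fun _ : Fin (J + 1) => E → Fin q)) (y, x')) e).card)
        = q ^ (Finset.univ.filter fun e => y e = g 0 (Fin.cons 0 x') e).card *
          q ^ (∑ j, (Finset.univ.filter fun e => x' j e
            = g j.succ (Fin.cons 0 x') e).card) := by
      intro x' y
      rw [Fin.sum_univ_succ, pow_add]
      have h0 : ∀ j, g j (Fin.cons y x') = g j (Fin.cons 0 x') := by
        intro j
        apply hg
        intro i hi
        obtain ⟨i', rfl⟩ := Fin.exists_succ_eq.2 (Fin.ne_zero_of_lt hi)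
        simp
      simp [Fin.consEquiv, h0]
    simp_rw [key, ← Finset.sum_mul]
    calc _ ≤ ∑ x' : Fin J → E → Fin q, (2 * q) ^ Fintype.card E *
          q ^ (∑ j, (Finset.univ.filter fun e => x' j e
            = g j.succ (Fin.cons 0 x') e).card) := by
          gcongr
          exact sum_pow_card_eq_le q _
      _ = (2 * q) ^ Fintype.card E * ∑ x' : Fin J → E → Fin q,
          q ^ (∑ j, (Finset.univ.filter fun e => x' j e
            = g j.succ (Fin.cons 0 x') e).card) := by rw [Finset.mul_sum]
      _ ≤ (2 * q) ^ Fintype.card E * (2 * q) ^ (J * Fintype.card E) := by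
          gcongr
          apply ih (fun j x' => g j.succ (Fin.cons 0 x'))
          intro j x y hxy
          apply hg
          intro i hi
          obtain ⟨i', rfl⟩ := Fin.exists_succ_eq.2 (Fin.ne_zero_of_lt hi)
          simpa using hxy i' (Fin.succ_lt_succ_iff.1 hi)
      _ = _ := by rw [← pow_add]; ring_nf

/-- If, from a state in `M`, the predictor is right on a fraction `δ` of all the symbols on average,
then `M` has at least `(q ^ δ / 2) ^ t` elements, where `t` is the number of symbols. -/
lemma rpow_le_card_mul_of_average_correct {M : Type*} [Fintype M] (q : ℕ) [NeZero q] (J : ℕ)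
    (enc : (Fin J → E → Fin q) → M)
    (g : M → Fin J → (Fin J → E → Fin q) → E → Fin q)
    (hg : ∀ s j x y, (∀ i, j < i → x i = y i) → g s j x = g s j y) (δ : ℝ)
    (h : δ * (J * Fintype.card E) * Fintype.card (Fin J → E → Fin q)
      ≤ ∑ x : Fin J → E → Fin q,
        ((∑ j, (Finset.univ.filter fun e => x j e = g (enc x) j x e).card : ℕ) : ℝ)) :
    (q : ℝ) ^ (δ * (J * Fintype.card E)) ≤ Fintype.card M * 2 ^ (J * Fintype.card E) := by
  set t := J * Fintype.card E with ht
  set N : (Fin J → E → Fin q) → ℕ :=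
    fun x => ∑ j, (Finset.univ.filter fun e => x j e = g (enc x) j x e).card with hN
  have hcard : Fintype.card (Fin J → E → Fin q) = q ^ t := by
    simp [ht, ← pow_mul, mul_comm]
  have hq0 : 0 < q := Nat.pos_of_ne_zero (NeZero.ne q)
  have hqR : (0 : ℝ) < q := by exact_mod_cast hq0
  have hq1 : (1 : ℝ) ≤ q := by exact_mod_cast hq0
  -- The actual state depends on x; summing over all states removes this dependence at the cost of
  -- the factor |M|.
  have h1 : ∑ x : Fin J → E → Fin q, q ^ N x ≤ Fintype.card M * (2 * q) ^ t := by
    calc ∑ x : Fin J → E → Fin q, q ^ N x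
        ≤ ∑ x : Fin J → E → Fin q, ∑ s : M,
          q ^ (∑ j, (Finset.univ.filter fun e => x j e = g s j x e).card) := by
          apply Finset.sum_le_sum
          intro x _
          exact Finset.single_le_sum (f := fun s : M =>
            q ^ (∑ j, (Finset.univ.filter fun e => x j e = g s j x e).card))
            (fun _ _ => Nat.zero_le _) (Finset.mem_univ (enc x))
      _ = ∑ s : M, ∑ x : Fin J → E → Fin q,
          q ^ (∑ j, (Finset.univ.filter fun e => x j e = g s j x e).card) := Finset.sum_comm
      _ ≤ ∑ _s : M, (2 * q) ^ t := by
          apply Finset.sum_le_sum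
          intro s _
          exact sum_pow_correct_le q J (g s) (hg s)
      _ = _ := by simp
  have h1' : ∑ x : Fin J → E → Fin q, (q : ℝ) ^ N x ≤ Fintype.card M * (2 * q) ^ t := by
    exact_mod_cast h1
  set d : ℝ := δ * (J * Fintype.card E) with hd
  -- Jensen by hand: the tangent line at d of the convex function q^·, to be averaged over x.
  have h2 : ∀ x, (q : ℝ) ^ d * (1 + (N x - d) * Real.log q) ≤ (q : ℝ) ^ N x := by
    intro x
    have e1 : (q : ℝ) ^ N x = (q : ℝ) ^ d * (q : ℝ) ^ ((N x : ℝ) - d) := by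
      rw [← Real.rpow_add hqR, ← Real.rpow_natCast]
      congr 1; ring
    rw [e1]
    gcongr
    rw [Real.rpow_def_of_pos hqR]
    have := Real.add_one_le_exp (Real.log q * ((N x : ℝ) - d))
    linarith
  have h3 : (q : ℝ) ^ d * (q : ℝ) ^ t ≤ ∑ x : Fin J → E → Fin q, (q : ℝ) ^ N x := by
    refine le_trans ?_ (Finset.sum_le_sum fun x _ => h2 x)
    rw [← Finset.mul_sum]
    gcongr
    rw [Finset.sum_add_distrib, ← Finset.sum_mul, Finset.sum_sub_distrib]
    simp only [Finset.sum_const, Finset.card_univ, hcard, nsmul_eq_mul]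
    rw [hcard] at h
    have hlog : 0 ≤ Real.log q := Real.log_nonneg hq1
    push_cast at h ⊢
    have : 0 ≤ (∑ x, (N x : ℝ) - (q : ℝ) ^ t * d) * Real.log q := by
      apply mul_nonneg _ hlog
      simp only [hN]
      push_cast
      linarith
    linarith
  have h4 : (q : ℝ) ^ d * (q : ℝ) ^ t ≤ (Fintype.card M * 2 ^ t) * (q : ℝ) ^ t := by
    calc _ ≤ _ := h3.trans h1'
      _ = _ := by rw [mul_pow]; ring
  exact le_of_mul_le_mul_right h4 (by positivity)

end Counting

/-- Averaging over the coins. -/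
lemma exists_le_card_mem_of_le_measureReal {Ω I : Type*} [MeasurableSpace Ω] [Fintype I]
    (μ : MeasureTheory.Measure Ω) [MeasureTheory.IsProbabilityMeasure μ] (s : I → Set Ω)
    (hs : ∀ i, MeasurableSet (s i)) (p : ℝ) (hp : ∀ i, p ≤ μ.real (s i)) :
    ∃ ω, p * Fintype.card I ≤ ∑ i, (s i).indicator (fun _ => (1 : ℝ)) ω := by
  have hint : ∀ i, MeasureTheory.Integrable ((s i).indicator fun _ => (1 : ℝ)) μ := fun i =>
    (MeasureTheory.integrable_const 1).indicator (hs i)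
  obtain ⟨ω, hω⟩ := MeasureTheory.exists_integral_le
    (MeasureTheory.integrable_finsetSum Finset.univ fun i _ => hint i)
  refine ⟨ω, le_trans ?_ hω⟩
  rw [MeasureTheory.integral_finsetSum _ fun i _ => hint i]
  calc p * Fintype.card I = ∑ _i : I, p := by simp [mul_comm]
    _ ≤ _ := Finset.sum_le_sum fun i _ => by
      rw [MeasureTheory.integral_indicator_const _ (hs i)]
      simpa using hp i

/-! ### Matrices written entry by entry -/

section Scatter

variable {m n : ℕ} {E R : Type*} [Fintype E]

/-- The matrix whose entry at `φ e` is `w e`, all other entries being zero. -/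
def scatter [AddCommMonoid R] (φ : E → Fin m × Fin n) (w : E → R) : Matrix (Fin m) (Fin n) R :=
  Matrix.of fun i j => ∑ e, if φ e = (i, j) then w e else 0

lemma scatter_apply_self [AddCommMonoid R] {φ : E → Fin m × Fin n} (hφ : Function.Injective φ)
    (w : E → R) (e : E) : scatter φ w (φ e).1 (φ e).2 = w e := by
  classical
  simp [scatter, hφ.eq_iff]

lemma scatter_apply_of_forall_ne [AddCommMonoid R] {φ : E → Fin m × Fin n} (w : E → R)
    {i : Fin m} {j : Fin n} (h : ∀ e, φ e ≠ (i, j)) : scatter φ w i j = 0 := by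
  simp [scatter, h]

lemma scatter_add [AddCommMonoid R] (φ : E → Fin m × Fin n) (v w : E → R) :
    scatter φ (v + w) = scatter φ v + scatter φ w := by
  ext i j
  simp only [scatter, Matrix.of_apply, Matrix.add_apply, ← Finset.sum_add_distrib]
  refine Finset.sum_congr rfl fun e _ => ?_
  split_ifs <;> simp

lemma scatter_transpose [AddCommMonoid R] (φ : E → Fin m × Fin n) (w : E → R) :
    (scatter φ w).transpose = scatter (fun e => (φ e).swap) w := by
  ext i j
  simp only [scatter, Matrix.transpose_apply, Matrix.of_apply]
  refine Finset.sum_congr rfl fun e _ => ?_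
  simp [Prod.ext_iff, and_comm]

lemma scatter_map_intCast (φ : E → Fin m × Fin n) (w : E → ℤ) :
    (scatter φ w).map (Int.cast : ℤ → ℝ) = scatter φ (fun e => (w e : ℝ)) := by
  ext i j
  simp [scatter, Matrix.map_apply]

lemma scatter_mem_of_injective {φ : E → Fin m × Fin n} (hφ : Function.Injective φ)
    (w : E → ℤ) {p : ℤ → Prop} (h0 : p 0) (h : ∀ e, p (w e)) (i : Fin m) (j : Fin n) :
    p (scatter φ w i j) := by
  by_cases hij : ∃ e, φ e = (i, j)
  · obtain ⟨e, he⟩ := hij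
    have := scatter_apply_self hφ w e
    rw [he] at this
    simpa [this] using h e
  · rw [scatter_apply_of_forall_ne w (by simpa using hij)]
    exact h0

end Scatter

/-! ### Streams -/

section Streams

variable {m n : ℕ}

lemma streamMatrix_append (σ τ : List (TurnstileUpdate m n)) :
    streamMatrix (σ ++ τ) = streamMatrix σ + streamMatrix τ := by
  simp [streamMatrix]

/-- The stream that writes the matrix `M`, one update for each entry. -/
noncomputable def matrixStream (M : Matrix (Fin m) (Fin n) ℤ) : List (TurnstileUpdate m n) :=
  (Finset.univ : Finset (Fin m × Fin n)).toList.map fun p => (p, M p.1 p.2)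

lemma length_matrixStream (M : Matrix (Fin m) (Fin n) ℤ) : (matrixStream M).length = m * n := by
  simp [matrixStream]

lemma streamMatrix_map_apply (M : Matrix (Fin m) (Fin n) ℤ) (L : List (Fin m × Fin n))
    (hL : L.Nodup) (i : Fin m) (j : Fin n) :
    streamMatrix (L.map fun p => (p, M p.1 p.2)) i j = if (i, j) ∈ L then M i j else 0 := by
  induction L with
  | nil => simp [streamMatrix]
  | cons p L ih =>
    have hcons : streamMatrix ((p :: L).map fun p => (p, M p.1 p.2))
        = Matrix.single p.1 p.2 (M p.1 p.2) + streamMatrix (L.map fun p => (p, M p.1 p.2)) := by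
      simp [streamMatrix]
    rw [hcons, Matrix.add_apply, ih hL.of_cons]
    have hp := (List.nodup_cons.1 hL).1
    by_cases h : p = (i, j)
    · subst h
      simp [hp]
    · have h' : ¬ (p.1 = i ∧ p.2 = j) := fun hh => h (Prod.ext hh.1 hh.2)
      have h'' : ¬ ((i, j) = p) := fun hh => h hh.symm
      simp [h', h'']

lemma streamMatrix_matrixStream (M : Matrix (Fin m) (Fin n) ℤ) :
    streamMatrix (matrixStream M) = M := by
  ext i j
  rw [matrixStream, streamMatrix_map_apply _ _ (Finset.nodup_toList _)]
  simp

/-- Each entry is written exactly once, so intermediate matrices never exceed the word size if the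
final one does not. -/
lemma streamMatrix_prefix_matrixStream (M : Matrix (Fin m) (Fin n) ℤ)
    {p : List (TurnstileUpdate m n)} (hp : p <+: matrixStream M) (i : Fin m) (j : Fin n) :
    streamMatrix p i j = M i j ∨ streamMatrix p i j = 0 := by
  rw [matrixStream, List.prefix_iff_eq_take, ← List.map_take] at hp
  rw [hp, streamMatrix_map_apply _ _ ((Finset.nodup_toList _).sublist (List.take_sublist _ _))]
  split_ifs <;> simp

lemma fitsWord_zero (ℓ : ℕ) : FitsWord ℓ 0 := by simp [FitsWord]

lemma isWordStream_append {ℓ : ℕ} (M N : Matrix (Fin m) (Fin n) ℤ)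
    (hM : ∀ i j, FitsWord ℓ (M i j)) (hN : ∀ i j, FitsWord ℓ (N i j))
    (hMN : ∀ i j, FitsWord ℓ (M i j + N i j)) :
    IsWordStream ℓ (matrixStream M ++ matrixStream N) := by
  constructor
  · intro u hu
    rcases List.mem_append.1 hu with hu | hu <;>
    · obtain ⟨p, -, rfl⟩ := List.mem_map.1 hu
      first | exact hM _ _ | exact hN _ _
  · intro p hp i j
    rcases List.prefix_or_prefix_of_prefix hp (List.prefix_append _ _) with hp | ⟨t, rfl⟩
    · rcases streamMatrix_prefix_matrixStream M hp i j with h | h <;> rw [h]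
      · exact hM _ _
      · exact fitsWord_zero ℓ
    · have ht := (List.prefix_append_right_inj _).1 hp
      rw [streamMatrix_append, Matrix.add_apply, streamMatrix_matrixStream]
      rcases streamMatrix_prefix_matrixStream N ht i j with h | h <;> rw [h]
      · exact hMN _ _
      · simpa using hM _ _

lemma TurnstileAlgorithm.runFrom_append {S ℓ : ℕ} {Ω : Type*} (alg : TurnstileAlgorithm m n S ℓ Ω)
    (ω : Ω) (σ ρ : List (TurnstileUpdate m n)) (τ : ℕ) (s : Memory S ℓ) :
    alg.runFrom ω τ s (σ ++ ρ) = alg.runFrom ω (τ + σ.length) (alg.runFrom ω τ s σ) ρ := by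
  induction σ generalizing τ s with
  | nil => simp [runFrom]
  | cons u σ ih =>
    simp only [List.cons_append, runFrom, List.length_cons]
    rw [ih]
    congr 1
    ring

end Streams

/-! ### Digits -/

section Digits

/-- The digit `a` for which `y` is closest to `U * a`. -/
noncomputable def nearestDigit (q : ℕ) [NeZero q] (U y : ℝ) : Fin q :=
  open Classical in
  if h : ∃ a : Fin q, 2 * |y - U * (a : ℕ)| < U then h.choose else 0

/-- Two multiples of U both closer than U/2 to y differ by less than U, hence coincide. -/
lemma nearestDigit_eq {q : ℕ} [NeZero q] {U y : ℝ} (a : Fin q) (h : 2 * |y - U * (a : ℕ)| < U) :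
    nearestDigit q U y = a := by
  have hex : ∃ a : Fin q, 2 * |y - U * (a : ℕ)| < U := ⟨a, h⟩
  rw [nearestDigit, dif_pos hex]
  have h' := hex.choose_spec
  set a' := hex.choose
  have hU : 0 < U := lt_of_le_of_lt (by positivity) h
  have h1 : U * |((a' : ℕ) : ℝ) - (a : ℕ)| < U * 1 := by
    rw [← abs_of_pos hU, ← abs_mul, abs_of_pos hU]
    have := abs_sub_le (U * ((a' : ℕ) : ℝ)) y (U * (a : ℕ))
    rw [abs_sub_comm (U * ((a' : ℕ) : ℝ)) y] at this
    rw [mul_sub]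
    linarith
  have h2 : |((a' : ℕ) : ℤ) - ((a : ℕ) : ℤ)| < 1 := by
    have := lt_of_mul_lt_mul_left h1 hU.le
    exact_mod_cast this
  have h3 := Int.abs_lt_one_iff.1 h2
  ext
  omega

variable {E : Type*} {q J : ℕ}

/-- The number with digits `x i` at the levels `i` in `s`, where level `i` has weight
`D * (8 * q) ^ i`. -/
def digitSum (D : ℕ) (s : Finset (Fin J)) (x : Fin J → E → Fin q) (e : E) : ℤ :=
  ∑ i ∈ s, (D * (8 * q) ^ (i : ℕ) : ℤ) * ((x i e : ℕ) : ℤ)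

lemma digitSum_nonneg (D : ℕ) (s : Finset (Fin J)) (x : Fin J → E → Fin q) (e : E) :
    0 ≤ digitSum D s x e := Finset.sum_nonneg fun i _ => by positivity

lemma four_mul_geom_sum_le (q j : ℕ) (hq : 0 < q) :
    4 * ∑ i ∈ Finset.range j, (8 * q) ^ i * q ≤ (8 * q) ^ j := by
  induction j with
  | zero => simp
  | succ j ih =>
    rw [Finset.sum_range_succ, pow_succ]
    nlinarith [Nat.pow_pos (n := j) (show 0 < 8 * q by omega)]

/-- The base 8q, rather than q, keeps all levels below j within a quarter of the unit of level j.
Another quarter is left for the approximation error, and together they stay below the rounding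
radius. -/
lemma four_mul_digitSum_lt_le (D : ℕ) (x : Fin J → E → Fin q) (e : E) (j : ℕ) :
    4 * digitSum D (Finset.univ.filter fun i => (i : ℕ) < j) x e ≤ D * (8 * q) ^ j := by
  rcases Nat.eq_zero_or_pos q with rfl | hq
  · have : J = 0 := by
      by_contra hJ
      exact (x ⟨0, Nat.pos_of_ne_zero hJ⟩ e).elim0
    subst this
    simp only [digitSum, Finset.univ_eq_empty, Finset.filter_empty, Finset.sum_empty]
    positivity
  have h := four_mul_geom_sum_le q j hq
  have h1 : digitSum D (Finset.univ.filter fun i => (i : ℕ) < j) x e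
      ≤ D * ∑ i ∈ Finset.range j, ((8 * q) ^ i * q : ℤ) := by
    calc digitSum D (Finset.univ.filter fun i => (i : ℕ) < j) x e
        ≤ ∑ i ∈ Finset.univ.filter (fun i : Fin J => (i : ℕ) < j),
            (D * ((8 * q) ^ (i : ℕ) * q) : ℤ) := by
          apply Finset.sum_le_sum
          intro i _
          rw [mul_assoc]
          gcongr
          exact_mod_cast (x i e).2.le
      _ = ∑ i ∈ (Finset.univ.filter (fun i : Fin J => (i : ℕ) < j)).map Fin.valEmbedding,
            (D * ((8 * q) ^ i * q) : ℤ) := by rw [Finset.sum_map]; rfl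
      _ ≤ ∑ i ∈ Finset.range j, (D * ((8 * q) ^ i * q) : ℤ) := by
          apply Finset.sum_le_sum_of_subset_of_nonneg
          · intro i hi
            simp only [Finset.mem_map, Finset.mem_filter, Finset.mem_univ, true_and] at hi
            obtain ⟨a, ha, rfl⟩ := hi
            simpa using ha
          · intros; positivity
      _ = _ := by rw [Finset.mul_sum]
  have h' : 4 * ∑ i ∈ Finset.range j, ((8 * q) ^ i * q : ℤ) ≤ (8 * q) ^ j := by exact_mod_cast h
  calc _ ≤ 4 * (D * ∑ i ∈ Finset.range j, ((8 * q) ^ i * q : ℤ)) := by linarith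
    _ = D * (4 * ∑ i ∈ Finset.range j, ((8 * q) ^ i * q : ℤ)) := by ring
    _ ≤ _ := by gcongr

lemma four_mul_digitSum_le (D : ℕ) (s : Finset (Fin J)) (x : Fin J → E → Fin q) (e : E) :
    4 * digitSum D s x e ≤ D * (8 * q) ^ J := by
  refine le_trans ?_ (four_mul_digitSum_lt_le D x e J)
  have : digitSum D s x e ≤ digitSum D (Finset.univ.filter fun i : Fin J => (i : ℕ) < J) x e := by
    apply Finset.sum_le_sum_of_subset_of_nonneg
    · intro i _; simp
    · intros; positivity
  linarith

lemma digitSum_Iic (D : ℕ) (x : Fin J → E → Fin q) (e : E) (j : Fin J) :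
    digitSum D (Finset.Iic j) x e = digitSum D (Finset.univ.filter fun i => (i : ℕ) < j) x e
      + (D * (8 * q) ^ (j : ℕ) : ℤ) * ((x j e : ℕ) : ℤ) := by
  have : Finset.Iic j = insert j (Finset.univ.filter fun i : Fin J => (i : ℕ) < j) := by
    ext i
    simp only [Finset.mem_Iic, Finset.mem_insert, Finset.mem_filter, Finset.mem_univ, true_and,
      Fin.le_def, Fin.ext_iff]
    omega
  rw [digitSum, this, Finset.sum_insert (by simp), add_comm]
  rfl

lemma digitSum_univ (D : ℕ) (x : Fin J → E → Fin q) (j : Fin J) :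
    digitSum D Finset.univ x = digitSum D (Finset.Iic j) x + digitSum D (Finset.Ioi j) x := by
  funext e
  simp only [digitSum, Pi.add_apply]
  rw [← Finset.sum_union]
  · congr 1
    ext i
    simpa using le_or_gt i j
  · rw [Finset.disjoint_left]
    intro i hi hi'
    simp only [Finset.mem_Iic, Finset.mem_Ioi] at hi hi'
    exact absurd hi (not_le.2 hi')

end Digits

/-! ### From a family of decodable blocks to a space bound -/

section SpaceBound

variable {m n : ℕ}

/-- Any low-rank approximation of the data `v`, completed by the matrix `G b`, agrees with the data
up to an error of a quarter of the unit `U` on nine tenths of the block `b`. -/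
def BlockDecodable {β F : Type*} [Fintype β] [Fintype F] (α γ : ℝ) (k q U : ℕ)
    (φ : β × F → Fin m × Fin n) (G : β → Matrix (Fin m) (Fin n) ℤ) : Prop :=
  ∀ (b : β) (v : β × F → ℤ), (∀ e, 0 ≤ v e) → (∀ e, v e ≤ q * U) →
    ∀ B : Matrix (Fin m) (Fin n) ℝ,
      IsLowRankApprox α γ k ((scatter φ v + G b).map (Int.cast : ℤ → ℝ)) B →
        (9 / 10 : ℝ) * Fintype.card F ≤
          (Finset.univ.filter fun f =>
            4 * |B (φ (b, f)).1 (φ (b, f)).2 - v (b, f)| < (U : ℝ)).card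

/-- The memory after writing the data is the message. From this one state every pair of a level and
a block can be queried by its own continuation, because the coins are fixed. -/
theorem rpow_le_of_blockDecodable {β F : Type*} [Fintype β] [Fintype F] {S ℓ k q D J : ℕ}
    [NeZero q] {α γ : ℝ} {φ : β × F → Fin m × Fin n} (hφ : Function.Injective φ)
    {G : β → Matrix (Fin m) (Fin n) ℤ}
    (hG : ∀ b i j, 4 * |G b i j| < 2 ^ ℓ) (hJ : D * (8 * q) ^ J ≤ 2 ^ ℓ)
    (hdec : ∀ j < J, BlockDecodable α γ k q (D * (8 * q) ^ j) φ G)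
    {Ω : Type*} [MeasurableSpace Ω] (μ : MeasureTheory.Measure Ω)
    [MeasureTheory.IsProbabilityMeasure μ] (alg : TurnstileAlgorithm m n S ℓ Ω)
    (halg : SolvesLRA μ alg α (5 / 6) γ k) :
    (q : ℝ) ^ ((3 / 20 : ℝ) * (J * (Fintype.card β * Fintype.card F)))
      ≤ 2 ^ (S * ℓ) * 2 ^ (J * (Fintype.card β * Fintype.card F)) := by
  classical
  let A : (Fin J → β × F → Fin q) → Matrix (Fin m) (Fin n) ℤ :=
    fun x => scatter φ (digitSum D Finset.univ x)
  let N : β → Fin J → (Fin J → β × F → Fin q) → Matrix (Fin m) (Fin n) ℤ :=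
    fun b j x => G b - scatter φ (digitSum D (Finset.Ioi j) x)
  have hAN : ∀ b j x, A x + N b j x = scatter φ (digitSum D (Finset.Iic j) x) + G b := by
    intro b j x
    simp only [A, N]
    rw [digitSum_univ D x j, scatter_add]
    abel
  have hJ' : (D * (8 * q) ^ J : ℤ) ≤ 2 ^ ℓ := by exact_mod_cast hJ
  have hsc : ∀ (s : Finset (Fin J)) (x : Fin J → β × F → Fin q) i j,
      0 ≤ scatter φ (digitSum D s x) i j ∧ 4 * scatter φ (digitSum D s x) i j ≤ 2 ^ ℓ := by
    intro s x i j
    refine scatter_mem_of_injective hφ _ (p := fun z => 0 ≤ z ∧ 4 * z ≤ 2 ^ ℓ) (by simp) ?_ i j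
    exact fun e => ⟨digitSum_nonneg _ _ _ _, (four_mul_digitSum_le D s x e).trans hJ'⟩
  have hpos : (0 : ℤ) < 2 ^ ℓ := by positivity
  -- Data is at most a quarter of 2^ℓ and `G b` strictly less, so sums and differences stay below
  -- half of it.
  have hword : ∀ b j x, IsWordStream ℓ (matrixStream (A x) ++ matrixStream (N b j x)) := by
    intro b j x
    refine isWordStream_append _ _ (fun i i' => ?_) (fun i i' => ?_) (fun i i' => ?_)
    · have := hsc Finset.univ x i i'
      rw [FitsWord, abs_of_nonneg this.1]
      linarith [this.2]
    · have := hsc (Finset.Ioi j) x i i'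
      have h1 := hG b i i'
      rw [FitsWord, show N b j x i i' = G b i i' - scatter φ (digitSum D (Finset.Ioi j) x) i i'
        from rfl]
      have h2 := abs_sub (G b i i') (scatter φ (digitSum D (Finset.Ioi j) x) i i')
      rw [abs_of_nonneg this.1] at h2
      linarith [this.2]
    · have := hsc (Finset.Iic j) x i i'
      have h1 := hG b i i'
      rw [FitsWord, ← Matrix.add_apply, hAN, Matrix.add_apply]
      have h2 := abs_add_le (scatter φ (digitSum D (Finset.Iic j) x) i i') (G b i i')
      rw [abs_of_nonneg this.1] at h2
      linarith [this.2]
  let good : (Fin J → β × F → Fin q) × Fin J × β → Set Ω := fun p =>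
    {ω | IsLowRankApprox α γ k
      ((scatter φ (digitSum D (Finset.Iic p.2.1) p.1) + G p.2.2).map (Int.cast : ℤ → ℝ))
      (alg.answer ω (matrixStream (A p.1) ++ matrixStream (N p.2.2 p.2.1 p.1)))}
  have hgood : ∀ p, MeasurableSet (good p) ∧ 1 - 5 / 6 ≤ μ.real (good p) := by
    intro p
    have := halg _ (hword p.2.2 p.2.1 p.1)
    rwa [streamMatrix_append, streamMatrix_matrixStream, streamMatrix_matrixStream, hAN] at this
  obtain ⟨ω, hω⟩ := exists_le_card_mem_of_le_measureReal μ good (fun p => (hgood p).1) _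
    (fun p => (hgood p).2)
  let enc : (Fin J → β × F → Fin q) → Memory S ℓ :=
    fun x => alg.runFrom ω 0 (alg.init ω) (matrixStream (A x))
  -- The continuation starts at time m * n, the length of the stream that writes the data.
  let out : Memory S ℓ → Fin J → (Fin J → β × F → Fin q) → β → Matrix (Fin m) (Fin n) ℝ :=
    fun s j x b => alg.output ω (alg.runFrom ω (m * n) s (matrixStream (N b j x)))
  let g : Memory S ℓ → Fin J → (Fin J → β × F → Fin q) → β × F → Fin q := fun s j x e =>
    nearestDigit q ((D * (8 * q) ^ (j : ℕ) : ℕ) : ℝ) (out s j x e.1 (φ e).1 (φ e).2)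
  have hg : ∀ s j x y, (∀ i, j < i → x i = y i) → g s j x = g s j y := by
    intro s j x y hxy
    have hd : digitSum D (Finset.Ioi j) x = digitSum D (Finset.Ioi j) y := by
      funext e
      refine Finset.sum_congr rfl fun i hi => ?_
      rw [hxy i (Finset.mem_Ioi.1 hi)]
    simp only [g, out, N, hd]
  have hans : ∀ x j b, alg.answer ω (matrixStream (A x) ++ matrixStream (N b j x))
      = out (enc x) j x b := by
    intro x j b
    simp only [TurnstileAlgorithm.answer, out, enc]
    rw [alg.runFrom_append, length_matrixStream, zero_add]
  have hblock : ∀ x j b, (good (x, j, b)).indicator (fun _ => (1 : ℝ)) ω *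
      ((9 / 10 : ℝ) * Fintype.card F) ≤
      ∑ f, if x j (b, f) = g (enc x) j x (b, f) then (1 : ℝ) else 0 := by
    intro x j b
    by_cases hx : ω ∈ good (x, j, b)
    · rw [Set.indicator_of_mem hx, one_mul]
      have h1 : IsLowRankApprox α γ k
          ((scatter φ (digitSum D (Finset.Iic j) x) + G b).map (Int.cast : ℤ → ℝ))
          (out (enc x) j x b) := by
        rw [← hans]; exact hx
      have hlow : ∀ e, 4 * (digitSum D (Finset.Iic j) x e
          - (D * (8 * q) ^ (j : ℕ) : ℤ) * ((x j e : ℕ) : ℤ)) ≤ D * (8 * q) ^ (j : ℕ) := by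
        intro e
        rw [digitSum_Iic, add_sub_cancel_right]
        exact four_mul_digitSum_lt_le D x e j
      have hlow' : ∀ e, 0 ≤ digitSum D (Finset.Iic j) x e
          - (D * (8 * q) ^ (j : ℕ) : ℤ) * ((x j e : ℕ) : ℤ) := by
        intro e
        rw [digitSum_Iic, add_sub_cancel_right]
        exact digitSum_nonneg _ _ _ _
      -- With U the unit of level j, the remaining value is at most (q - 1)U + U/4 ≤ qU.
      have h2 := hdec j j.2 b _ (digitSum_nonneg D (Finset.Iic j) x) (fun e => by
        have h3 := hlow e
        have h4 : ((x j e : ℕ) : ℤ) + 1 ≤ q := by exact_mod_cast (x j e).2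
        have h5 : (0 : ℤ) ≤ D * (8 * q) ^ (j : ℕ) := by positivity
        push_cast
        nlinarith [mul_le_mul_of_nonneg_left h4 h5]) _ h1
      refine h2.trans ?_
      rw [Finset.sum_boole]
      gcongr with f _
      intro hf
      symm
      apply nearestDigit_eq
      have h6 : |(digitSum D (Finset.Iic j) x (b, f) : ℝ)
          - ((D * (8 * q) ^ (j : ℕ) : ℕ) : ℝ) * ((x j (b, f) : ℕ) : ℝ)|
          ≤ ((D * (8 * q) ^ (j : ℕ) : ℕ) : ℝ) / 4 := by
        have h7 := hlow (b, f)
        have h8 := hlow' (b, f)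
        have h7' : (4 * (digitSum D (Finset.Iic j) x (b, f)
          - (D * (8 * q) ^ (j : ℕ) : ℝ) * ((x j (b, f) : ℕ) : ℝ)) : ℝ)
            ≤ D * (8 * q) ^ (j : ℕ) := by exact_mod_cast h7
        have h8' : (0 : ℝ) ≤ (digitSum D (Finset.Iic j) x (b, f)
          - (D * (8 * q) ^ (j : ℕ) : ℝ) * ((x j (b, f) : ℕ) : ℝ) : ℝ) := by exact_mod_cast h8
        push_cast
        rw [abs_of_nonneg h8']
        linarith
      have h9 := abs_sub_le (out (enc x) j x b (φ (b, f)).1 (φ (b, f)).2)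
        (digitSum D (Finset.Iic j) x (b, f) : ℝ)
        (((D * (8 * q) ^ (j : ℕ) : ℕ) : ℝ) * ((x j (b, f) : ℕ) : ℝ))
      linarith
    · rw [Set.indicator_of_notMem hx, zero_mul]
      exact Finset.sum_nonneg fun f _ => by split_ifs <;> norm_num
  -- 3/20 = (1/6)·(9/10): the success probability times the fraction decoded on success.
  have hcount := rpow_le_card_mul_of_average_correct q J enc g hg (3 / 20) (by
    have h1 : ∀ x, ((∑ j, (Finset.univ.filter fun e => x j e = g (enc x) j x e).card : ℕ) : ℝ)
        = ∑ j, ∑ b, ∑ f, if x j (b, f) = g (enc x) j x (b, f) then (1 : ℝ) else 0 := by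
      intro x
      push_cast
      refine Finset.sum_congr rfl fun j _ => ?_
      rw [← Fintype.sum_prod_type', Finset.sum_boole]
    simp_rw [h1]
    calc _ = ((1 - 5 / 6) * Fintype.card ((Fin J → β × F → Fin q) × Fin J × β) : ℝ)
            * ((9 / 10 : ℝ) * Fintype.card F) := by
          simp only [Fintype.card_prod, Fintype.card_fin]
          push_cast
          ring
      _ ≤ (∑ p, (good p).indicator (fun _ => (1 : ℝ)) ω) * ((9 / 10 : ℝ) * Fintype.card F) := by
          gcongr
      _ = ∑ x, ∑ j, ∑ b, (good (x, j, b)).indicator (fun _ => (1 : ℝ)) ω *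
            ((9 / 10 : ℝ) * Fintype.card F) := by
          rw [Finset.sum_mul, Fintype.sum_prod_type]
          refine Finset.sum_congr rfl fun x _ => ?_
          rw [Fintype.sum_prod_type]
      _ ≤ _ := Finset.sum_le_sum fun x _ => Finset.sum_le_sum fun j _ =>
          Finset.sum_le_sum fun b _ => hblock x j b)
  have hM : Fintype.card (Memory S ℓ) = 2 ^ (S * ℓ) := by
    simp [← pow_mul, mul_comm]
  rw [hM, Fintype.card_prod] at hcount
  exact_mod_cast hcount

end SpaceBound

/-! ### The Frobenius norm and the low-rank error -/

section Frobenius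

lemma frobenius_norm_sq {ι κ : Type*} [Fintype ι] [Fintype κ] (Z : Matrix ι κ ℝ) :
    ‖Z‖ ^ 2 = ∑ p : ι × κ, Z p.1 p.2 ^ 2 := by
  rw [Matrix.frobenius_norm_def, ← Real.sqrt_eq_rpow, Real.sq_sqrt (by positivity),
    Fintype.sum_prod_type]
  simp

lemma sum_sq_le_frobenius_norm_sq {ι κ E : Type*} [Fintype ι] [Fintype κ] [Fintype E]
    (Z : Matrix ι κ ℝ) {ψ : E → ι × κ} (hψ : Function.Injective ψ) :
    ∑ e, Z (ψ e).1 (ψ e).2 ^ 2 ≤ ‖Z‖ ^ 2 := by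
  classical
  rw [frobenius_norm_sq]
  calc ∑ e, Z (ψ e).1 (ψ e).2 ^ 2
      = ∑ p ∈ Finset.univ.image ψ, Z p.1 p.2 ^ 2 := by
        rw [Finset.sum_image fun _ _ _ _ h => hψ h]
    _ ≤ _ := Finset.sum_le_sum_of_subset_of_nonneg (Finset.subset_univ _)
        fun _ _ _ => sq_nonneg _

lemma abs_apply_le_frobenius_norm {ι κ : Type*} [Fintype ι] [Fintype κ] (Z : Matrix ι κ ℝ)
    (i : ι) (j : κ) : |Z i j| ≤ ‖Z‖ := by
  have h := sum_sq_le_frobenius_norm_sq Z (ψ := fun _ : Unit => (i, j))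
    (Function.injective_of_subsingleton _)
  simp only [Finset.univ_unique, Finset.sum_singleton] at h
  exact abs_le_of_sq_le_sq h (norm_nonneg _)

lemma frobenius_norm_submatrix_le {ι κ ι' κ' : Type*} [Fintype ι] [Fintype κ] [Fintype ι']
    [Fintype κ'] (Z : Matrix ι κ ℝ) {r : ι' → ι} {c : κ' → κ} (hr : Function.Injective r)
    (hc : Function.Injective c) : ‖Z.submatrix r c‖ ≤ ‖Z‖ := by
  have h := sum_sq_le_frobenius_norm_sq Z (hr.prodMap hc)
  have h2 : ‖Z.submatrix r c‖ ^ 2 ≤ ‖Z‖ ^ 2 := by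
    rw [frobenius_norm_sq (Z.submatrix r c)]
    simpa using h
  exact le_of_sq_le_sq h2 (norm_nonneg _)

variable {m n : ℕ}

lemma norm_sq_scatter {E : Type*} [Fintype E] {φ : E → Fin m × Fin n}
    (hφ : Function.Injective φ) (w : E → ℝ) : ‖scatter φ w‖ ^ 2 = ∑ e, w e ^ 2 := by
  rw [frobenius_norm_sq]
  symm
  refine Fintype.sum_of_injective φ hφ _ _ (fun p hp => ?_) (fun e => ?_)
  · rw [scatter_apply_of_forall_ne w (fun e he => hp ⟨e, he⟩)]
    simp
  · rw [scatter_apply_self hφ]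

lemma lowRankError_le {k : ℕ} (A X : Matrix (Fin m) (Fin n) ℝ) (hX : X.rank ≤ k) :
    lowRankError k A ≤ ‖A - X‖ :=
  ciInf_le (f := fun X : {X : Matrix (Fin m) (Fin n) ℝ // X.rank ≤ k} => ‖A - X.1‖)
    ⟨0, by rintro _ ⟨X, rfl⟩; exact norm_nonneg _⟩ ⟨X, hX⟩

lemma lowRankError_transpose_le (k : ℕ) (A : Matrix (Fin m) (Fin n) ℝ) :
    lowRankError k A.transpose ≤ lowRankError k A := by
  have : Nonempty {X : Matrix (Fin m) (Fin n) ℝ // X.rank ≤ k} := ⟨⟨0, by simp⟩⟩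
  refine le_ciInf fun X => ?_
  refine (lowRankError_le A.transpose X.1.transpose
    (by rw [Matrix.rank_transpose]; exact X.2)).trans (le_of_eq ?_)
  rw [← Matrix.transpose_sub, Matrix.frobenius_norm_transpose]

lemma lowRankError_transpose (k : ℕ) (A : Matrix (Fin m) (Fin n) ℝ) :
    lowRankError k A.transpose = lowRankError k A :=
  le_antisymm (lowRankError_transpose_le k A) (lowRankError_transpose_le k A.transpose)

lemma IsLowRankApprox.transpose {α γ : ℝ} {k : ℕ} {A B : Matrix (Fin m) (Fin n) ℝ}
    (h : IsLowRankApprox α γ k A B) : IsLowRankApprox α γ k A.transpose B.transpose := by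
  refine ⟨by rw [Matrix.rank_transpose]; exact h.1, ?_⟩
  rw [← Matrix.transpose_sub, Matrix.frobenius_norm_transpose, lowRankError_transpose]
  exact h.2

lemma BlockDecodable.transpose {β F : Type*} [Fintype β] [Fintype F] {α γ : ℝ} {k q U : ℕ}
    {φ : β × F → Fin m × Fin n} {G : β → Matrix (Fin m) (Fin n) ℤ}
    (h : BlockDecodable α γ k q U φ G) :
    BlockDecodable α γ k q U (fun e => (φ e).swap) (fun b => (G b).transpose) := by
  intro b v hv0 hv B hB
  have h1 := hB.transpose
  rw [← scatter_transpose, ← Matrix.transpose_add, Matrix.transpose_map, Matrix.transpose_transpose]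
    at h1
  refine (h b v hv0 hv B.transpose h1).trans
    (Nat.cast_le.2 (Finset.card_le_card fun f hf => ?_))
  rw [Finset.mem_filter] at hf ⊢
  exact ⟨Finset.mem_univ f, hf.2⟩

end Frobenius

/-! ### Matrices of rank at most `k` with a dominant `k × k` minor -/

/-- If a `k × k` submatrix of a matrix `B` of rank at most `k` is within `T` of `P` times the
identity, then every entry in a row that is small on the columns of the submatrix is small. -/
lemma abs_apply_le_of_rank_le {m n k : ℕ} (B : Matrix (Fin m) (Fin n) ℝ) (hB : B.rank ≤ k)
    (r : Fin k → Fin m) (c : Fin k → Fin n) (i : Fin m) (j : Fin n) (P T H : ℝ)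
    (hTP : T < P) (hE : ‖B.submatrix r c - P • (1 : Matrix (Fin k) (Fin k) ℝ)‖ ≤ T)
    (hy : ‖B.submatrix (fun _ : Unit => i) c‖ ≤ T)
    (hH : ‖B.submatrix r (fun _ : Unit => j)‖ ≤ H) :
    |B i j| ≤ T / (P - T) * H := by
  have hT0 : 0 ≤ T := (norm_nonneg _).trans hE
  have hPT : 0 < P - T := by linarith
  -- Row i together with the k rows r makes k + 1 rows of a matrix of rank at most k.
  have hdep :
      ¬ LinearIndependent ℝ (B.submatrix (fun o : Option (Fin k) => o.elim i r) id).row := by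
    intro hli
    have h1 := hli.rank_matrix
    have h2 := B.rank_submatrix_le (fun o : Option (Fin k) => o.elim i r) id
    rw [h1, Fintype.card_option, Fintype.card_fin] at h2
    omega
  obtain ⟨w, hw, hw0⟩ := Fintype.not_linearIndependent_iff.1 hdep
  have hrel : ∀ j', w none * B i j' + ∑ a, w (some a) * B (r a) j' = 0 := by
    intro j'
    have := congrFun hw j'
    simpa [Fintype.sum_option, Finset.sum_apply] using this
  set u : Matrix Unit (Fin k) ℝ := Matrix.of fun _ a => w (some a) with hu
  -- On the columns c the dependence reads u(P·1 + E) = -w·y, where w is the coefficient of row i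
  -- and E, y have norm at most T. So u has norm at most |w|T/(P - T); in particular w ≠ 0, and
  -- column j then bounds the entry.
  have h1 : P • u = -(u * (B.submatrix r c - P • (1 : Matrix (Fin k) (Fin k) ℝ)))
      - w none • B.submatrix (fun _ : Unit => i) c := by
    ext x a
    have := hrel (c a)
    simp only [Matrix.mul_sub, Matrix.sub_apply, Matrix.neg_apply, Matrix.smul_apply,
      Matrix.mul_smul, Matrix.mul_one, smul_eq_mul, Matrix.submatrix_apply, Matrix.mul_apply,
      hu, Matrix.of_apply]
    linarith
  have hP0 : 0 < P := by linarith
  have h2 : P * ‖u‖ ≤ ‖u‖ * T + |w none| * T := by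
    calc P * ‖u‖ = ‖P • u‖ := by rw [norm_smul, Real.norm_of_nonneg hP0.le]
      _ ≤ ‖u * (B.submatrix r c - P • (1 : Matrix (Fin k) (Fin k) ℝ))‖
          + ‖w none • B.submatrix (fun _ : Unit => i) c‖ := by
            rw [h1]
            refine (norm_sub_le _ _).trans ?_
            rw [norm_neg]
      _ ≤ _ := by
          refine add_le_add ((Matrix.frobenius_norm_mul _ _).trans ?_) ?_
          · gcongr
          · rw [norm_smul, Real.norm_eq_abs]
            gcongr
  have h3 : ‖u‖ ≤ |w none| * (T / (P - T)) := by
    rw [mul_div_assoc', le_div_iff₀ hPT]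
    linarith
  have hne : w none ≠ 0 := by
    intro h0
    rw [h0, abs_zero, zero_mul] at h3
    have hu0 : u = 0 := norm_le_zero_iff.1 h3
    obtain ⟨o, ho⟩ := hw0
    cases o with
    | none => exact ho h0
    | some a => exact ho (by simpa [hu] using congrFun (congrFun hu0 ()) a)
  have h4 : w none * B i j = -(u * B.submatrix r (fun _ : Unit => j)) () () := by
    have := hrel j
    simp only [Matrix.mul_apply, hu, Matrix.of_apply, Matrix.submatrix_apply]
    linarith
  have hH0 : 0 ≤ H := (norm_nonneg _).trans hH
  have h5 : |w none| * |B i j| ≤ |w none| * (T / (P - T) * H) := by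
    rw [← abs_mul, h4, abs_neg, ← mul_assoc]
    refine (abs_apply_le_frobenius_norm _ _ _).trans ((Matrix.frobenius_norm_mul _ _).trans ?_)
    exact mul_le_mul h3 hH (norm_nonneg _) (by positivity)
  exact le_of_mul_le_mul_left h5 (abs_pos.2 hne)

/-! ### Two families of decodable blocks -/

section Blocks

variable {m n : ℕ}

lemma sum_ite_fst_eq {β F : Type*} [Fintype β] [Fintype F] [DecidableEq β] (b : β)
    (g : β × F → ℝ) : (∑ e : β × F, if e.1 = b then g e else 0) = ∑ f, g (b, f) := by
  rw [Fintype.sum_prod_type, Finset.sum_comm]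
  simp

lemma sq_sub_mul_le_sq_sub {x y η w : ℝ} (hη : 0 ≤ η) (hx : |x| ≤ η) (hy : 0 ≤ y) (hw : y ≤ w) :
    y ^ 2 - 2 * η * w ≤ (y - x) ^ 2 := by
  have h : x * y ≤ η * w :=
    (mul_le_mul_of_nonneg_right (abs_le.1 hx).2 hy).trans (mul_le_mul_of_nonneg_left hw hη)
  nlinarith [sq_nonneg x]

/-- The error budget of a dominant block, with a the norm of the other blocks, f the block size and
t the number of data entries. Half of U²f/160 pays for 3αa²; the other half covers 4aγ, γ² and the
leakage of the approximation into the other blocks. -/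
lemma excess_le {α γ M q U P N a f t : ℝ} (hα0 : 0 ≤ α) (hα1 : α ≤ 1)
    (hα : 960 * q ^ 2 * α * N ≤ 1) (hγ0 : 0 ≤ γ) (hq : 0 < q) (hU : 0 < U) (hP0 : 0 < P)
    (ha : 0 ≤ a) (haM : a ≤ M * (q * U)) (haN : a ^ 2 ≤ N * f * (q * U) ^ 2)
    (hγ : 4000 * q * M * γ ≤ U) (hγU : γ ≤ U / 4000) (hP : 48000 * M ^ 4 * q ^ 3 * U ≤ P)
    (hf : 1 ≤ f) (ht : t ≤ M ^ 2) :
    ((1 + α) * a + γ) ^ 2 - a ^ 2 + t * (2 * (24 * M ^ 2 * q ^ 2 * U ^ 2 / P) * (q * U))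
      ≤ U ^ 2 * f / 160 := by
  have e1 : α * a ^ 2 ≤ f * U ^ 2 / 960 := by
    calc α * a ^ 2 ≤ α * (N * f * (q * U) ^ 2) := by gcongr
      _ = (960 * q ^ 2 * α * N) * (f * U ^ 2) / 960 := by ring
      _ ≤ 1 * (f * U ^ 2) / 960 := by gcongr
      _ = _ := by ring
  have e2 : a * γ ≤ U ^ 2 / 4000 := by
    calc a * γ ≤ M * (q * U) * γ := by gcongr
      _ = (4000 * q * M * γ) * U / 4000 := by ring
      _ ≤ U * U / 4000 := by gcongr
      _ = _ := by ring
  have e3 : γ ^ 2 ≤ U ^ 2 / 4000 := by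
    calc γ ^ 2 ≤ (U / 4000) ^ 2 := by gcongr
      _ ≤ _ := by nlinarith [sq_nonneg U]
  have e4 : t * (2 * (24 * M ^ 2 * q ^ 2 * U ^ 2 / P) * (q * U)) ≤ U ^ 2 / 1000 := by
    calc _ ≤ M ^ 2 * (2 * (24 * M ^ 2 * q ^ 2 * U ^ 2 / P) * (q * U)) := by gcongr
      _ = (48000 * M ^ 4 * q ^ 3 * U) * U ^ 2 / (1000 * P) := by field_simp; ring
      _ ≤ P * U ^ 2 / (1000 * P) := by gcongr
      _ = _ := by field_simp
  have e5 : ((1 + α) * a + γ) ^ 2 ≤ a ^ 2 + 3 * (α * a ^ 2) + 4 * (a * γ) + γ ^ 2 := by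
    have h1 : α * (α * a ^ 2) ≤ 1 * (α * a ^ 2) := by gcongr
    have h2 : α * (a * γ) ≤ 1 * (a * γ) := by gcongr
    nlinarith
  have e6 : U ^ 2 ≤ U ^ 2 * f :=
    le_mul_of_one_le_right (by positivity) hf
  linarith [sq_nonneg U]

/-- Markov's inequality: each bad entry costs at least U²/16, so at most a tenth are bad. -/
lemma le_card_filter_of_sum_sq_le {F : Type*} [Fintype F] (y : F → ℝ) (U : ℝ) (hU : 0 < U)
    (h : ∑ f, y f ^ 2 ≤ U ^ 2 * Fintype.card F / 160) :
    (9 / 10 : ℝ) * Fintype.card F ≤ (Finset.univ.filter fun f => 4 * |y f| < U).card := by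
  classical
  have h1 : (Finset.univ.filter fun f => ¬ 4 * |y f| < U).card * (U ^ 2 / 16) ≤ ∑ f, y f ^ 2 := by
    rw [← nsmul_eq_mul]
    refine (Finset.card_nsmul_le_sum _ (fun f => y f ^ 2) _ fun f hf => ?_).trans
      (Finset.sum_le_sum_of_subset_of_nonneg (Finset.subset_univ _) fun _ _ _ => sq_nonneg _)
    have hf' : U ≤ 4 * |y f| := not_lt.1 (Finset.mem_filter.1 hf).2
    rw [← sq_abs (y f)]
    nlinarith
  have h2 : ((Finset.univ.filter fun f => 4 * |y f| < U).card : ℝ)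
      + (Finset.univ.filter fun f => ¬ 4 * |y f| < U).card = Fintype.card F := by
    exact_mod_cast Finset.card_filter_add_card_filter_not (s := (Finset.univ : Finset F))
      (fun f => 4 * |y f| < U)
  have h3 : U ^ 2 * ((Finset.univ.filter fun f => ¬ 4 * |y f| < U).card : ℝ)
      ≤ U ^ 2 * (Fintype.card F / 10) := by linarith
  have h4 := le_of_mul_le_mul_left h3 (by positivity)
  linarith

/-- A block of at most `k` full rows is determined up to the additive error. -/
lemma blockDecodable_rows {k k' q U : ℕ} {α γ : ℝ} (hα : 0 < α) (hk : k' ≤ k) (hU : 4 * γ < U)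
    {r : Fin k' → Fin m} (hr : Function.Injective r) :
    BlockDecodable (n := n) α γ k q U
      (fun e : Fin 1 × (Fin k' × Fin n) => (r e.2.1, e.2.2)) 0 := by
  intro b v _ _ B hB
  set A := (scatter (fun e : Fin 1 × (Fin k' × Fin n) => (r e.2.1, e.2.2)) v +
    (0 : Fin 1 → Matrix (Fin m) (Fin n) ℤ) b).map (Int.cast : ℤ → ℝ) with hA
  -- The matrix is supported on k' ≤ k rows, hence is its own best approximation.
  have herr : lowRankError k A ≤ 0 := by
    have h := lowRankError_le (k := k) A A ((Matrix.rank_le_card_of_support_subset _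
      (Finset.univ.image r) (fun i hi => by
        by_contra hi'
        have hi'' : ∀ a, r a ≠ i := by simpa using hi'
        apply hi
        funext j
        have h0 : scatter (fun e : Fin 1 × (Fin k' × Fin n) => (r e.2.1, e.2.2)) v i j = 0 :=
          scatter_apply_of_forall_ne _ fun e he => hi'' _ (Prod.mk.inj he).1
        simp [hA, Matrix.row, h0])).trans ((Finset.card_image_le.trans (by simp)).trans hk))
    simpa using h
  have hn : ‖A - B‖ ≤ γ := hB.2.trans (by nlinarith)
  have hall : (Finset.univ.filter fun f : Fin k' × Fin n =>
      4 * |B (r f.1) f.2 - v (b, f)| < (U : ℝ)) = Finset.univ := by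
    rw [Finset.filter_eq_self]
    intro f _
    have h1 := abs_apply_le_frobenius_norm (A - B) (r f.1) f.2
    have h2 : A (r f.1) f.2 = v (b, f) := by
      have := scatter_apply_self (φ := fun e : Fin 1 × (Fin k' × Fin n) => (r e.2.1, e.2.2))
        (fun e e' h => by
          have h2 := hr (Prod.mk.inj h).1
          have h3 := (Prod.mk.inj h).2
          exact Prod.ext (Subsingleton.elim _ _) (Prod.ext h2 h3)) v (b, f)
      simp only at this
      simp [hA, this]
    rw [Matrix.sub_apply, h2, abs_sub_comm] at h1
    linarith
  simp only
  rw [hall, Finset.card_univ]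
  have : (0 : ℝ) ≤ Fintype.card (Fin k' × Fin n) := by positivity
  linarith

section Dominant

variable {n' : ℕ} {k : ℕ} {N : ℕ}

/-- The entries of `N` blocks of `k` rows, in `n'` columns. -/
def dataEntry (r : Fin N × Fin k → Fin m) (c : Fin k ⊕ Fin n' → Fin n)
    (e : Fin N × (Fin k × Fin n')) : Fin m × Fin n :=
  (r (e.1, e.2.1), c (Sum.inr e.2.2))

/-- The matrix that is `P` times the identity in the rows of the block `b` and the `k` columns
that contain no data. -/
def dominantBlock (r : Fin N × Fin k → Fin m) (c : Fin k ⊕ Fin n' → Fin n) (P : ℕ) (b : Fin N) :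
    Matrix (Fin m) (Fin n) ℤ :=
  scatter (fun a : Fin k => (r (b, a), c (Sum.inl a))) fun _ => (P : ℤ)

variable {r : Fin N × Fin k → Fin m} {c : Fin k ⊕ Fin n' → Fin n}

lemma dataEntry_injective (hr : Function.Injective r) (hc : Function.Injective c) :
    Function.Injective (dataEntry r c) := by
  rintro ⟨b, a, j⟩ ⟨b', a', j'⟩ h
  simp only [dataEntry, Prod.mk.injEq] at h
  have h1 := hr h.1
  have h2 := hc h.2
  simp_all

lemma dominantEntry_injective (hc : Function.Injective c) (b : Fin N) :
    Function.Injective fun a : Fin k => (r (b, a), c (Sum.inl a)) := by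
  intro a a' h
  simpa using hc (Prod.mk.inj h).2

lemma abs_dominantBlock_le (hc : Function.Injective c) (P : ℕ) (b : Fin N) (i : Fin m)
    (j : Fin n) : |dominantBlock r c P b i j| ≤ P :=
  scatter_mem_of_injective (dominantEntry_injective hc b) _ (p := fun z => |z| ≤ (P : ℤ))
    (by simp) (by simp) i j

/-- A low-rank approximation has to spend its rank on the block with the dominant entries, and it
reproduces that block up to a small fraction of the norm of the other blocks. -/
lemma blockDecodable_dominant (hr : Function.Injective r) (hc : Function.Injective c)
    {q U P : ℕ} {α γ M : ℝ} (hα0 : 0 ≤ α) (hα1 : α ≤ 1) (hα : 960 * q ^ 2 * α * N ≤ 1)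
    (hγ0 : 0 ≤ γ) (hq : 0 < q) (hU : 0 < U) (hM1 : 1 ≤ M) (hM : (N * (k * n') : ℝ) ≤ M ^ 2)
    (hγ : 4000 * q * M * γ ≤ U) (hP : 48000 * M ^ 4 * q ^ 3 * U ≤ P) :
    BlockDecodable α γ k q U (dataEntry r c) (dominantBlock r c P) := by
  classical
  intro b v hv0 hv B hB
  rcases Nat.eq_zero_or_pos (Fintype.card (Fin k × Fin n')) with hF | hF
  · rw [hF]; simp
  have hφ := dataEntry_injective hr hc
  set φ := dataEntry r c with hφdef
  have hqR : (1 : ℝ) ≤ q := by exact_mod_cast hq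
  have hUR : (1 : ℝ) ≤ U := by exact_mod_cast hU
  have hFR : (1 : ℝ) ≤ Fintype.card (Fin k × Fin n') := by exact_mod_cast hF
  have hcardE : (Fintype.card (Fin N × (Fin k × Fin n')) : ℝ)
      = N * Fintype.card (Fin k × Fin n') := by
    rw [Fintype.card_prod, Fintype.card_fin]; push_cast; ring
  have hcardM : (Fintype.card (Fin N × (Fin k × Fin n')) : ℝ) ≤ M ^ 2 := by
    simpa using hM
  set V : Matrix (Fin m) (Fin n) ℝ := scatter φ (fun e => (v e : ℝ)) with hVdef
  set D : Matrix (Fin m) (Fin n) ℝ :=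
    scatter (fun a : Fin k => (r (b, a), c (Sum.inl a))) (fun _ => (P : ℝ)) with hDdef
  have hA : (scatter φ v + dominantBlock r c P b).map (Int.cast : ℤ → ℝ) = V + D := by
    rw [Matrix.map_add _ (by simp), scatter_map_intCast, dominantBlock, scatter_map_intCast]
    simp [hVdef, hDdef]
  rw [hA] at hB
  have hVφ : ∀ e, V (φ e).1 (φ e).2 = v e := scatter_apply_self hφ _
  have hVl : ∀ i a, V i (c (Sum.inl a)) = 0 := by
    intro i a
    refine scatter_apply_of_forall_ne _ fun e he => ?_
    simpa using hc (Prod.mk.inj he).2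
  have hDr : ∀ i j, D i (c (Sum.inr j)) = 0 := by
    intro i a
    refine scatter_apply_of_forall_ne _ fun e he => ?_
    simpa using hc (Prod.mk.inj he).2
  have hDrow : ∀ i j, (∀ a, r (b, a) ≠ i) → D i j = 0 := by
    intro i j hi
    exact scatter_apply_of_forall_ne _ fun a ha => hi a (Prod.mk.inj ha).1
  have hDb : D.submatrix (fun a => r (b, a)) (fun a => c (Sum.inl a))
      = (P : ℝ) • (1 : Matrix (Fin k) (Fin k) ℝ) := by
    ext a a'
    simp only [Matrix.submatrix_apply, Matrix.smul_apply, Matrix.one_apply, smul_eq_mul]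
    by_cases h : a = a'
    · subst h
      have := scatter_apply_self (dominantEntry_injective (r := r) hc b) (fun _ => (P : ℝ)) a
      simpa [hDdef] using this
    · rw [if_neg h, mul_zero]
      refine scatter_apply_of_forall_ne _ fun a'' ha => h ?_
      have h1 := hr (Prod.mk.inj ha).1
      have h2 := hc (Prod.mk.inj ha).2
      simp only [Prod.mk.injEq, true_and, Sum.inl.injEq] at h1 h2
      rw [← h1, ← h2]
  -- norms of the data
  have hvR : ∀ e, (0 : ℝ) ≤ v e ∧ (v e : ℝ) ≤ q * U := fun e =>
    ⟨by exact_mod_cast hv0 e, by exact_mod_cast hv e⟩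
  have hsq : ∀ e, (v e : ℝ) ^ 2 ≤ (q * U) ^ 2 := fun e =>
    pow_le_pow_left₀ (hvR e).1 (hvR e).2 2
  have hVn : ‖V‖ ≤ M * (q * U) := by
    refine le_of_sq_le_sq ?_ (by positivity)
    rw [hVdef, norm_sq_scatter hφ, mul_pow]
    calc ∑ e, (v e : ℝ) ^ 2 ≤ ∑ _e : Fin N × (Fin k × Fin n'), (q * U : ℝ) ^ 2 :=
          Finset.sum_le_sum fun e _ => hsq e
      _ = Fintype.card (Fin N × (Fin k × Fin n')) * (q * U : ℝ) ^ 2 := by simp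
      _ ≤ _ := by gcongr
  set W : Matrix (Fin m) (Fin n) ℝ := scatter φ (fun e => if e.1 = b then 0 else (v e : ℝ)) with hW
  have hWsq : ‖W‖ ^ 2 = ∑ e, if e.1 = b then 0 else (v e : ℝ) ^ 2 := by
    rw [hW, norm_sq_scatter hφ]
    exact Finset.sum_congr rfl fun e _ => by split_ifs <;> simp
  have hWN : ‖W‖ ^ 2 ≤ N * Fintype.card (Fin k × Fin n') * (q * U) ^ 2 := by
    rw [hWsq, ← hcardE]
    calc _ ≤ ∑ _e : Fin N × (Fin k × Fin n'), (q * U : ℝ) ^ 2 :=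
          Finset.sum_le_sum fun e _ => by
            split_ifs
            · positivity
            · exact hsq e
      _ = _ := by simp
  have hWn : ‖W‖ ≤ M * (q * U) := by
    refine le_of_sq_le_sq (hWN.trans ?_) (by positivity)
    rw [← hcardE, mul_pow M]
    gcongr
  -- the optimal error
  have herr : lowRankError k (V + D) ≤ ‖W‖ := by
    -- The competitor keeps exactly the k rows of block b and drops all other data.
    have hX := lowRankError_le (k := k) (V + D) (V + D - W) (by
      refine (Matrix.rank_le_card_of_support_subset _
        (Finset.univ.image fun a : Fin k => r (b, a)) ?_).trans
        (Finset.card_image_le.trans (by simp))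
      intro i hi
      by_contra hi'
      have hi'' : ∀ a, r (b, a) ≠ i := by simpa using hi'
      apply hi
      funext j
      simp only [Matrix.row, Matrix.sub_apply, Matrix.add_apply, Pi.zero_apply]
      rw [hDrow i j hi'', add_zero, hVdef, hW]
      simp only [scatter, Matrix.of_apply]
      rw [← Finset.sum_sub_distrib]
      refine Finset.sum_eq_zero fun e _ => ?_
      by_cases he : φ e = (i, j)
      · have hb : e.1 ≠ b := by
          rintro rfl
          exact hi'' e.2.1 (Prod.mk.inj he).1
        simp [he, hb]
      · simp [he])
    simpa using hX
  have hT : ‖V + D - B‖ ≤ (1 + α) * ‖W‖ + γ := hB.2.trans (by gcongr)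
  have hγU : γ ≤ U / 4000 := by
    have : (4000 : ℝ) * γ ≤ 4000 * q * M * γ := by
      have h1 : (1 : ℝ) ≤ q * M := one_le_mul_of_one_le_of_one_le hqR hM1
      nlinarith
    linarith
  have hMqU : (U : ℝ) ≤ M * (q * U) := by
    have h1 : (1 : ℝ) ≤ M * q := one_le_mul_of_one_le_of_one_le hM1 hqR
    nlinarith
  -- Twice the bound on ‖W‖ for (1 + α)‖W‖, and once more for γ.
  set T : ℝ := 3 * (M * (q * U)) with hTdef
  have hT' : ‖V + D - B‖ ≤ T := by
    refine hT.trans ?_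
    have : (1 + α) * ‖W‖ ≤ 2 * (M * (q * U)) := by
      apply mul_le_mul _ hWn (norm_nonneg _) (by norm_num)
      linarith
    linarith
  have hT'' : ‖B - (V + D)‖ ≤ T := by rw [norm_sub_rev]; exact hT'
  have hTP : 2 * T ≤ P := by
    refine le_trans ?_ hP
    have h1 : M * q ≤ M ^ 4 * q ^ 3 := by
      gcongr
      · exact le_self_pow₀ hM1 (by norm_num)
      · exact le_self_pow₀ hqR (by norm_num)
    have h2 : M * q * U ≤ M ^ 4 * q ^ 3 * U := by gcongr
    rw [hTdef]
    have : 0 ≤ M * q * U := by positivity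
    linarith
  have hT0 : 0 < T := by positivity
  have hP0 : (0 : ℝ) < P := by linarith
  -- the entries of the approximation outside the block
  set η : ℝ := 24 * M ^ 2 * q ^ 2 * U ^ 2 / P with hη
  have hrb : Function.Injective fun a : Fin k => r (b, a) := fun a a' h => by simpa using hr h
  have hcl : Function.Injective fun a : Fin k => c (Sum.inl a) := fun a a' h => by
    simpa using hc h
  have hsmall : ∀ e, e.1 ≠ b → |B (φ e).1 (φ e).2| ≤ η := by
    intro e he
    have h1 := abs_apply_le_of_rank_le B hB.1 (fun a => r (b, a)) (fun a => c (Sum.inl a))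
      (φ e).1 (φ e).2 P T (4 * (M * (q * U))) (by linarith) (by
        rw [← hDb]
        refine le_trans (le_of_eq ?_)
          ((frobenius_norm_submatrix_le (B - (V + D)) hrb hcl).trans hT'')
        congr 1
        ext a a'
        simp [hVl]) (by
        refine le_trans (le_of_eq ?_) ((frobenius_norm_submatrix_le (B - (V + D))
          (r := fun _ : Unit => (φ e).1) (Function.injective_of_subsingleton _) hcl).trans hT'')
        congr 1
        ext a a'
        have : D (φ e).1 (c (Sum.inl a')) = 0 := by
          apply hDrow
          intro a'' h
          have := hr h
          simp only [Prod.mk.injEq] at this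
          exact he this.1.symm
        simp [hVl, this]) (by
        have h2 : B.submatrix (fun a => r (b, a)) (fun _ : Unit => (φ e).2)
            = (B - (V + D)).submatrix (fun a => r (b, a)) (fun _ : Unit => (φ e).2)
              + V.submatrix (fun a => r (b, a)) (fun _ : Unit => (φ e).2) := by
          ext a x
          have : D (r (b, a)) (φ e).2 = 0 := hDr _ _
          simp [this]
        rw [h2]
        refine (norm_add_le _ _).trans ?_
        have h3 := (frobenius_norm_submatrix_le (B - (V + D)) hrb
          (c := fun _ : Unit => (φ e).2) (Function.injective_of_subsingleton _)).trans hT''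
        have h4 := (frobenius_norm_submatrix_le V hrb
          (c := fun _ : Unit => (φ e).2) (Function.injective_of_subsingleton _)).trans hVn
        linarith)
    refine h1.trans ?_
    have h5 : T / (P - T) ≤ T / (P / 2) := by
      apply div_le_div_of_nonneg_left hT0.le (by positivity)
      linarith
    calc T / (P - T) * (4 * (M * (q * U))) ≤ T / (P / 2) * (4 * (M * (q * U))) := by gcongr
      _ = η := by rw [hη, hTdef]; field_simp; ring
  have hη0 : 0 ≤ η := by positivity
  -- comparison of the squared errors
  have hsum : ∑ f, (B (φ (b, f)).1 (φ (b, f)).2 - v (b, f)) ^ 2 + ‖W‖ ^ 2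
      - Fintype.card (Fin N × (Fin k × Fin n')) * (2 * η * (q * U)) ≤ ‖V + D - B‖ ^ 2 := by
    refine le_trans ?_ (sum_sq_le_frobenius_norm_sq (V + D - B) hφ)
    have h1 : ∑ f, (B (φ (b, f)).1 (φ (b, f)).2 - v (b, f)) ^ 2
        = ∑ e, if e.1 = b then (B (φ e).1 (φ e).2 - v e) ^ 2 else 0 := by
      exact (sum_ite_fst_eq b fun e => (B (φ e).1 (φ e).2 - v e) ^ 2).symm
    have h2 : (Fintype.card (Fin N × (Fin k × Fin n')) : ℝ) * (2 * η * (q * U))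
        = ∑ _e : Fin N × (Fin k × Fin n'), 2 * η * (q * U) := by simp
    rw [h1, hWsq, h2, ← Finset.sum_add_distrib, ← Finset.sum_sub_distrib]
    refine Finset.sum_le_sum fun e _ => ?_
    have hD0 : D (φ e).1 (φ e).2 = 0 := hDr _ _
    rw [Matrix.sub_apply, Matrix.add_apply, hVφ, hD0, add_zero]
    have h3 : 0 ≤ 2 * η * (q * U) := by positivity
    by_cases he : e.1 = b
    · rw [if_pos he, if_pos he, add_zero, sub_sq_comm]
      exact sub_le_self _ h3
    · rw [if_neg he, if_neg he, zero_add]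
      exact sq_sub_mul_le_sq_sub hη0 (hsmall e he) (hvR e).1 (hvR e).2
  apply le_card_filter_of_sum_sq_le _ (U : ℝ) (by positivity)
  have hTsq : ‖V + D - B‖ ^ 2 ≤ ((1 + α) * ‖W‖ + γ) ^ 2 :=
    pow_le_pow_left₀ (norm_nonneg _) hT 2
  have hexc := excess_le hα0 hα1 hα hγ0 (by linarith) (by linarith) hP0 (norm_nonneg W) hWn hWN hγ
    hγU hP hFR hcardM
  linarith

end Dominant

end Blocks

/-! ### Choice of the parameters -/

lemma IsLowRankApprox.mono {m n k : ℕ} {α γ γ' : ℝ} (hγ : γ ≤ γ') {A B : Matrix (Fin m) (Fin n) ℝ}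
    (h : IsLowRankApprox α γ k A B) : IsLowRankApprox α γ' k A B :=
  ⟨h.1, h.2.trans (by gcongr)⟩

lemma BlockDecodable.anti {m n : ℕ} {β F : Type*} [Fintype β] [Fintype F] {α γ γ' : ℝ}
    (hγ : γ ≤ γ') {k q U : ℕ} {φ : β × F → Fin m × Fin n} {G : β → Matrix (Fin m) (Fin n) ℤ}
    (h : BlockDecodable α γ' k q U φ G) : BlockDecodable α γ k q U φ G :=
  fun b v hv0 hv B hB => h b v hv0 hv B (hB.mono hγ)

/-- There are decodable blocks with a total of at least `2 ^ (-54) * (m + n) * k / α` entries. -/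
def HasLargeBlocks (m n k q D Umax P : ℕ) (α γ : ℝ) : Prop :=
  ∃ (N k' n' : ℕ) (φ : Fin N × (Fin k' × Fin n') → Fin m × Fin n)
    (G : Fin N → Matrix (Fin m) (Fin n) ℤ), Function.Injective φ ∧ (∀ b i j, |G b i j| ≤ P) ∧
    (∀ U, D ≤ U → U ≤ Umax → BlockDecodable α γ k q U φ G) ∧
    ((m : ℝ) + n) * k / α ≤ 2 ^ 54 * (N * (k' * n') : ℝ)

lemma HasLargeBlocks.swap {m n k q D Umax P : ℕ} {α γ : ℝ}
    (h : HasLargeBlocks m n k q D Umax P α γ) : HasLargeBlocks n m k q D Umax P α γ := by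
  obtain ⟨N, k', n', φ, G, hφ, hG, hdec, hcard⟩ := h
  refine ⟨N, k', n', fun e => (φ e).swap, fun b => (G b).transpose,
    Prod.swap_injective.comp hφ, fun b i j => hG b j i,
    fun U h1 h2 => (hdec U h1 h2).transpose, ?_⟩
  rwa [add_comm (n : ℝ)]

lemma hasLargeBlocks_of_small {m n k q D Umax P : ℕ} {α γ : ℝ} (hq : q = 2 ^ 20) (hmn : m ≤ n)
    (hk : 1 ≤ k) (hα : 0 < α) (hα' : α * 2 ^ 50 ≤ 1) (hkm : (k : ℝ) ≤ 10 * α * m) (hγ0 : 0 ≤ γ)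
    (hγ : 4000 * q * ((m : ℝ) + n) * γ ≤ D) (hD : 0 < D)
    (hP : 48000 * ((m : ℝ) + n) ^ 4 * q ^ 3 * Umax ≤ P) :
    HasLargeBlocks m n k q D Umax P α γ := by
  have hkR : (1 : ℝ) ≤ k := by exact_mod_cast hk
  have hmnR : (m : ℝ) ≤ n := by exact_mod_cast hmn
  have hm0 : (0 : ℝ) ≤ m := by positivity
  -- The largest N with N·α·2^50 ≤ 1; as 960q² ≤ 2^50 this meets the budget on α. The floor loses at
  -- most a factor 2, and k ≤ 10αm leaves room for N·k rows.
  set N := ⌊1 / (α * 2 ^ 50)⌋₊ with hN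
  have hpos : 0 < α * 2 ^ 50 := by positivity
  have hN1 : 1 ≤ N := by
    rw [hN, Nat.one_le_floor_iff, le_div_iff₀ hpos]
    linarith
  have hN1R : (1 : ℝ) ≤ N := by exact_mod_cast hN1
  have hNα : (N : ℝ) * (α * 2 ^ 50) ≤ 1 := by
    rw [← le_div_iff₀ hpos]
    exact Nat.floor_le (by positivity)
  have hNα' : 1 ≤ 2 * N * (α * 2 ^ 50) := by
    have h1 := Nat.lt_floor_add_one (1 / (α * 2 ^ 50))
    rw [← hN, div_lt_iff₀ hpos] at h1
    nlinarith
  have hNk : (N * k : ℝ) ≤ m / 2 := by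
    have h1 : (N * k : ℝ) ≤ N * (10 * α * m) := by gcongr
    have h2 : (N : ℝ) * (α * 2 ^ 50) * m ≤ 1 * m := by gcongr
    nlinarith
  have hkm2 : (k : ℝ) ≤ m / 2 := by nlinarith
  have hNkm : N * k ≤ m := by
    have : ((N * k : ℕ) : ℝ) ≤ m := by push_cast; linarith
    exact_mod_cast this
  have hkn : k ≤ n := by
    have : (k : ℝ) ≤ n := by linarith
    exact_mod_cast this
  have hn' : ((n - k : ℕ) : ℝ) = n - k := Nat.cast_sub hkn
  let r : Fin N × Fin k → Fin m := fun p => Fin.castLE hNkm (finProdFinEquiv p)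
  have hr : Function.Injective r := (Fin.castLE_injective hNkm).comp finProdFinEquiv.injective
  have hkn' : k + (n - k) ≤ n := by omega
  let c : Fin k ⊕ Fin (n - k) → Fin n := fun p => Fin.castLE hkn' (finSumFinEquiv p)
  have hc : Function.Injective c := (Fin.castLE_injective hkn').comp finSumFinEquiv.injective
  refine ⟨N, k, n - k, dataEntry r c, dominantBlock r c P, dataEntry_injective hr hc,
    fun b i j => abs_dominantBlock_le hc P b i j, fun U hU1 hU2 => ?_, ?_⟩
  · have hU1R : (D : ℝ) ≤ U := by exact_mod_cast hU1
    have hU2R : (U : ℝ) ≤ Umax := by exact_mod_cast hU2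
    refine blockDecodable_dominant hr hc (M := (m : ℝ) + n) hα.le (by linarith) ?_ hγ0
      (by rw [hq]; positivity) (hD.trans_le hU1) (by linarith) ?_ (hγ.trans hU1R)
      (le_trans (by gcongr) hP)
    · rw [hq]
      push_cast
      nlinarith [mul_nonneg hα.le (by linarith : (0 : ℝ) ≤ N)]
    · have h1 : (N * k : ℝ) * ((n - k : ℕ) : ℝ) ≤ m * n := by
        apply mul_le_mul _ _ (by positivity) (by positivity)
        · linarith
        · rw [hn']; linarith
      nlinarith
  · rw [div_le_iff₀ hα, hn']
    have h1 : ((m : ℝ) + n) ≤ 4 * (n - k) := by linarith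
    have h2 : (0 : ℝ) ≤ n - k := by linarith
    calc ((m : ℝ) + n) * k ≤ 4 * (n - k) * k * 1 := by rw [mul_one]; gcongr
      _ ≤ 4 * (n - k) * k * (2 * N * (α * 2 ^ 50)) := by gcongr
      _ ≤ 2 ^ 54 * (N * (k * (n - k))) * α := by
        have : (0 : ℝ) ≤ N * (k * (n - k)) * α := by positivity
        nlinarith

/-- Here 1/α < 2^50, so one block of min(k, m) full rows already has the right order of size; if k >
m, the bound k ≤ 10αm replaces k/α by a multiple of m. -/
lemma hasLargeBlocks_of_large {m n k q D Umax P : ℕ} {α γ : ℝ} (hmn : m ≤ n)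
    (hα : 0 < α) (hα' : 1 < α * 2 ^ 50) (hkm : (k : ℝ) ≤ 10 * α * m) (hγ : 4 * γ < D) :
    HasLargeBlocks m n k q D Umax P α γ := by
  have hmnR : (m : ℝ) ≤ n := by exact_mod_cast hmn
  have hr := Fin.castLE_injective (min_le_right k m)
  refine ⟨1, min k m, n, fun e => (Fin.castLE (min_le_right k m) e.2.1, e.2.2), 0, ?_, by simp,
    fun U hU1 _ => blockDecodable_rows hα (min_le_left k m) ?_ hr, ?_⟩
  · intro e e' h
    exact Prod.ext (Subsingleton.elim _ _)
      (Prod.ext (hr (Prod.mk.inj h).1) (Prod.mk.inj h).2)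
  · have : (D : ℝ) ≤ U := by exact_mod_cast hU1
    linarith
  · have h1 : (k : ℝ) / α ≤ 2 ^ 50 * (min k m : ℕ) := by
      rw [div_le_iff₀ hα]
      rcases min_cases k m with ⟨h, -⟩ | ⟨h, -⟩ <;> rw [h]
      · have : (0 : ℝ) ≤ k := by positivity
        nlinarith
      · have : (0 : ℝ) ≤ α * m := by positivity
        nlinarith
    calc ((m : ℝ) + n) * k / α = (m + n) * (k / α) := by ring
      _ ≤ (n + n) * (2 ^ 50 * (min k m : ℕ)) := by gcongr
      _ ≤ _ := by
        have : (0 : ℝ) ≤ n * (min k m : ℕ) := by positivity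
        push_cast at this ⊢
        nlinarith

lemma hasLargeBlocks {m n k q D Umax P : ℕ} {α γ : ℝ} (hq : q = 2 ^ 20)
    (hk : 1 ≤ k) (hα : 0 < α) (hkm : (k : ℝ) / (20 * α) ≤ (min m n : ℕ) / 2) (hγ0 : 0 ≤ γ)
    (hγ : 4000 * q * ((m : ℝ) + n) * γ ≤ D) (hD : 0 < D) (hγD : 4 * γ < D)
    (hP : 48000 * ((m : ℝ) + n) ^ 4 * q ^ 3 * Umax ≤ P) :
    HasLargeBlocks m n k q D Umax P α γ := by
  have hkm' : (k : ℝ) ≤ 10 * α * (min m n : ℕ) := by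
    rw [div_le_iff₀ (by positivity)] at hkm
    linarith
  rcases le_total m n with hmn | hmn
  · rw [min_eq_left hmn] at hkm'
    rcases le_or_gt (α * 2 ^ 50) 1 with h | h
    · exact hasLargeBlocks_of_small hq hmn hk hα h hkm' hγ0 hγ hD hP
    · exact hasLargeBlocks_of_large hmn hα h hkm' hγD
  · rw [min_eq_right hmn] at hkm'
    rw [add_comm (m : ℝ)] at hγ hP
    rcases le_or_gt (α * 2 ^ 50) 1 with h | h
    · exact (hasLargeBlocks_of_small hq hmn hk hα h hkm' hγ0 hγ hD hP).swap
    · exact (hasLargeBlocks_of_large hmn hα h hkm' hγD).swap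

lemma pow_mul_two_pow_le {M z J ℓ : ℕ} (hM : 0 < M)
    (h : (z : ℝ) * Real.logb 2 M + J ≤ ℓ) : M ^ z * 2 ^ J ≤ 2 ^ ℓ := by
  have hMR : (0 : ℝ) < M := by exact_mod_cast hM
  have h1 : (M : ℝ) = 2 ^ Real.logb 2 M := (Real.rpow_logb (by norm_num) (by norm_num) hMR).symm
  have h2 : (M : ℝ) ^ z * 2 ^ J ≤ 2 ^ ℓ := by
    calc (M : ℝ) ^ z * 2 ^ J = (2 : ℝ) ^ ((z : ℝ) * Real.logb 2 M + J) := by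
          rw [Real.rpow_add (by norm_num), Real.rpow_natCast, mul_comm (z : ℝ),
            Real.rpow_mul (by norm_num), ← h1, Real.rpow_natCast]
      _ ≤ (2 : ℝ) ^ (ℓ : ℝ) := Real.rpow_le_rpow_of_exponent_le (by norm_num) h
      _ = _ := Real.rpow_natCast _ _
  exact_mod_cast h2

/-- The alphabet size 2^20 makes the left side 2^(3t), which beats the loss 2^t of the counting
bound. -/
lemma two_mul_le_of_rpow_le {t a : ℕ}
    (h : ((2 ^ 20 : ℕ) : ℝ) ^ ((3 / 20 : ℝ) * t) ≤ 2 ^ a * 2 ^ t) : 2 * t ≤ a := by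
  have h1 : ((2 ^ 20 : ℕ) : ℝ) ^ ((3 / 20 : ℝ) * t) = 2 ^ (3 * t) := by
    rw [Nat.cast_pow, Nat.cast_ofNat, ← Real.rpow_natCast, ← Real.rpow_mul (by norm_num),
      ← Real.rpow_natCast]
    congr 1
    push_cast
    ring
  rw [h1, ← pow_add, pow_le_pow_iff_right₀ (by norm_num)] at h
  omega

theorem mainTheorem4 :
    ∃ c : ℝ, 0 < c ∧ ∀ C : ℝ, 0 < C → ∃ K : ℝ, 0 < K ∧
      ∀ (m n k ℓ S : ℕ) (α γ : ℝ), 0 < α → γ ≤ C * ((m : ℝ) + n) →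
        (k : ℝ) / (20 * α) ≤ (min m n : ℕ) / 2 →
        K * Real.logb 2 ((m : ℝ) + n) ≤ ℓ →
        ∀ (Ω : Type*) [MeasurableSpace Ω] (μ : MeasureTheory.Measure Ω)
          [MeasureTheory.IsProbabilityMeasure μ] (alg : TurnstileAlgorithm m n S ℓ Ω),
          SolvesLRA μ alg α (5 / 6) γ k →
            c * (((m : ℝ) + n) * k / α) ≤ S := by
  -- 2^60 exceeds 2^54·46: the block size loses 2^54 and the number of levels 46.
  refine ⟨1 / 2 ^ 60, by positivity, fun C hC => ?_⟩
  obtain ⟨q, hq⟩ : ∃ q : ℕ, q = 2 ^ 20 := ⟨_, rfl⟩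
  have hq1 : 1 ≤ q := by rw [hq]; exact Nat.one_le_two_pow
  have : NeZero q := ⟨by omega⟩
  have hqR : (1 : ℝ) ≤ q := by exact_mod_cast hq1
  obtain ⟨D₀, hD₀⟩ := exists_nat_ge (4000 * q * (C + 1))
  have hD₀R : (1 : ℝ) ≤ D₀ := by nlinarith
  have hD₀1 : 1 ≤ D₀ := by exact_mod_cast hD₀R
  -- Constants depending on C are absorbed into (m + n)^z, as m + n ≥ 2. In K, the term 2(z + 6)
  -- makes (m + n)^(z+6) fit in half a word and 100 forces ℓ ≥ 100.
  obtain ⟨z, hz⟩ : ∃ z : ℕ, 4 * (48000 * q ^ 3 * D₀) < 2 ^ z := ⟨_, Nat.lt_two_pow_self⟩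
  refine ⟨2 * (z + 6) + 100, by positivity, ?_⟩
  intro m n k ℓ S α γ hα hγ hkm hℓ Ω _ μ _ alg halg
  rcases Nat.eq_zero_or_pos k with rfl | hk
  · simp
  have hmin : 1 ≤ min m n := by
    by_contra h
    have h0 : min m n = 0 := by omega
    rw [h0] at hkm
    have hkR : (0 : ℝ) < k := by exact_mod_cast hk
    have : 0 < (k : ℝ) / (20 * α) := by positivity
    simp only [Nat.cast_zero, zero_div] at hkm
    linarith
  have hm : 1 ≤ m := hmin.trans (min_le_left _ _)
  have hn : 1 ≤ n := hmin.trans (min_le_right _ _)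
  set M := m + n with hM
  have hMcast : (m : ℝ) + n = (M : ℝ) := by rw [hM]; push_cast; ring
  have hM2 : 2 ≤ M := by omega
  have hM2R : (2 : ℝ) ≤ M := by exact_mod_cast hM2
  rw [hMcast] at hℓ hγ
  have hlog : 1 ≤ Real.logb 2 M := by
    rw [Real.le_logb_iff_rpow_le (by norm_num) (by linarith)]
    simpa using hM2R
  have hzR : (0 : ℝ) ≤ z := by positivity
  have hℓ100 : 100 ≤ ℓ := by
    have : (100 : ℝ) ≤ ℓ := by nlinarith
    exact_mod_cast this
  -- As 8q = 2^23, the J levels occupy at most half of the ℓ bits.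
  set J := ℓ / 46 with hJ
  set D := D₀ * M ^ 2 with hD
  set Umax := D * (8 * q) ^ J with hUmax
  set P := 48000 * M ^ 4 * q ^ 3 * Umax with hP
  have hDpos : 0 < D := by positivity
  have h8q : 8 * q = 2 ^ 23 := by rw [hq]; norm_num
  have hJℓ : 46 * J ≤ ℓ := Nat.mul_div_le ℓ 46
  have hPℓ : 4 * P < 2 ^ ℓ := by
    have h1 : M ^ (z + 6) * 2 ^ (23 * J) ≤ 2 ^ ℓ := by
      apply pow_mul_two_pow_le (by omega)
      have h2 : (46 * J : ℝ) ≤ ℓ := by exact_mod_cast hJℓ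
      push_cast
      nlinarith
    calc 4 * P = 4 * (48000 * q ^ 3 * D₀) * (M ^ 6 * 2 ^ (23 * J)) := by
          rw [hP, hUmax, hD, h8q, ← pow_mul]; ring
      _ < 2 ^ z * (M ^ 6 * 2 ^ (23 * J)) := by gcongr
      _ ≤ M ^ z * (M ^ 6 * 2 ^ (23 * J)) := by gcongr
      _ = M ^ (z + 6) * 2 ^ (23 * J) := by ring
      _ ≤ 2 ^ ℓ := h1
  have hDR : 4000 * q * (C + 1) * (M : ℝ) ^ 2 ≤ D := by
    rw [hD]; push_cast; gcongr
  -- The blocks are built for the additive error C·(m + n), which is nonnegative, and passed on to γ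
  -- by monotonicity.
  obtain ⟨N, k', n', φ, G, hφ, hG, hdec, hcard⟩ :=
    hasLargeBlocks (m := m) (n := n) (D := D) (Umax := Umax) (P := P) (γ := C * M) hq hk hα hkm
      (by positivity) (by
        rw [hMcast]
        refine le_trans ?_ hDR
        have : (0 : ℝ) ≤ 4000 * q * (M : ℝ) ^ 2 := by positivity
        nlinarith) hDpos (by
        refine lt_of_lt_of_le ?_ hDR
        have h1 : (M : ℝ) ≤ M ^ 2 := le_self_pow₀ (by linarith) (by norm_num)
        have h2 : (C + 1) * M ≤ q * (C + 1) * (M : ℝ) ^ 2 := by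
          gcongr
          exact le_mul_of_one_le_left (by positivity) hqR
        nlinarith) (by
        rw [hMcast, hP]
        push_cast
        exact le_rfl)
  have hbound := rpow_le_of_blockDecodable (J := J) (D := D) hφ
    (fun b i j => by
      have h1 := hG b i j
      have h2 : (4 * P : ℤ) < 2 ^ ℓ := by exact_mod_cast hPℓ
      linarith)
    (by
      have h1 : Umax ≤ P := by
        rw [hP]
        exact Nat.le_mul_of_pos_left _ (by positivity)
      omega)
    (fun j hj => (hdec _ (Nat.le_mul_of_pos_right _ (by positivity)) (by
      rw [hUmax]
      gcongr
      omega)).anti hγ) μ alg halg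
  simp only [Fintype.card_prod, Fintype.card_fin] at hbound
  have h2t : 2 * (J * (N * (k' * n'))) ≤ S * ℓ := by
    apply two_mul_le_of_rpow_le
    rw [← hq]
    exact_mod_cast hbound
  have hJ92 : ℓ ≤ 92 * J := by omega
  have hS : ℓ * (N * (k' * n')) ≤ ℓ * (46 * S) := by
    calc ℓ * (N * (k' * n')) ≤ 92 * J * (N * (k' * n')) := by gcongr
      _ = 46 * (2 * (J * (N * (k' * n')))) := by ring
      _ ≤ 46 * (S * ℓ) := by gcongr
      _ = _ := by ring
  have hS' : N * (k' * n') ≤ 46 * S := Nat.le_of_mul_le_mul_left hS (by omega)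
  have hS'' : (N * (k' * n') : ℝ) ≤ 46 * S := by exact_mod_cast hS'
  have hS0 : (0 : ℝ) ≤ S := by positivity
  calc (1 / 2 ^ 60 : ℝ) * (((m : ℝ) + n) * k / α) ≤ (1 / 2 ^ 60 : ℝ) * (2 ^ 54 * (46 * S)) := by
        gcongr
        exact hcard.trans (by gcongr)
    _ ≤ (S : ℝ) := by linarith
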